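/- Let $G$ be a second countable locally compact (Hausdorff) topological group acting by isometries on a Polish metric space $(\mathcal X,d)$. For $Y\subseteq\mathcal X$ let $\mathrm{stab}_G(Y)$ be the pointwise stabilizer of $Y$. Assume that the action is strongly topological: for every finite $Y\subseteq\mathcal X$ and every $x\in\mathcal X\setminus Y$ the group $\mathrm{stab}_G(Y\cup\{x\})$ is closed in $\mathrm{stab}_G(Y)$ and is a null set for the Haar measure of $\mathrm{stab}_G(Y)$. Assume also that $\mathrm{stab}_G(Y)\neq\{1\}$ for every finite $Y\subset\mathcal X$. Let $t\ge 0$ and let $\mathbb F_t$ be the free group on $y_1,\dots,y_t$. Write $\mathrm{supp}(v)=\{x\in\mathcal X: vx\neq x\}$ for $v\in G$. For $w\in\mathbb F_t\subseteq\mathbb F_t*G$ put $O_w=\mathcal X\setminus\mathrm{Fix}(G)$, where $\mathrm{Fix}(G)$ is the set of points fixed by all of $G$. For $w\in(\mathbb F_t*G)\setminus\mathbb F_t$ of the reduced form $w=\mathsf u_nv_n\cdots\mathsf u_1v_1$ with $n\ge1$, $\mathsf u_i\in\mathbb F_t$, $v_i\in G\setminus\{1\}$ and $\mathsf u_i\neq1$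 for $i<n$, put $$O_w=\bigcap_{i=0}^{n-1}v_1^{-1}v_2^{-1}\cdots v_i^{-1}\bigl(\mathrm{supp}(v_{i+1})\bigr).$$ A word $w$ of one of these two kinds is called explicitly oscillating if $w\ne1$ and $O_w\neq\emptyset$. Let $W\subseteq\mathbb F_t*G$ be a countable set (for instance a single word) of explicitly oscillating words $w$ with $O_w=\mathcal X$. Then a random $t$-tuple $\bar\gamma\in G^t$ almost surely satisfies all the mixed inequalities $w(\bar y)\neq1$ with $w\in W$: for almost all $\bar\gamma\in G^t$, with respect to the product of the Haar measure on $G$, one has $w(\bar\gamma)\neq1$ for every $w\in W$. -/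

import Mathlib

open MeasureTheory Set
open scoped Pointwise Monoid.Coprod

namespace MixedInequality

section Words

variable {G : Type*} [Group G] {t : ℕ}

/-- The word `𝗎ₙ vₙ ⋯ 𝗎₂ v₂ 𝗎₁ v₁` in the free product `𝔽ₜ ∗ G`, given by the list
`[(𝗎₁, v₁), (𝗎₂, v₂), …, (𝗎ₙ, vₙ)]`. -/
def ofForm : List (FreeGroup (Fin t) × G) → FreeGroup (Fin t) ∗ G
  | [] => 1
  | (u, v) :: L => ofForm L * (Monoid.Coprod.inl u * Monoid.Coprod.inr v)

/-- The list `[(𝗎₁, v₁), …, (𝗎ₙ, vₙ)]` describes a reduced word `𝗎ₙ vₙ ⋯ 𝗎₁ v₁`: `n ≥ 1`, every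
constant `vᵢ` is non-trivial, and so is every `𝗎ᵢ` standing between two constants (that is, with
`i < n`; the leftmost factor `𝗎ₙ` may be trivial). -/
def IsReducedForm (L : List (FreeGroup (Fin t) × G)) : Prop :=
  L ≠ [] ∧ (∀ a ∈ L, a.2 ≠ 1) ∧ ∀ a ∈ L.dropLast, a.1 ≠ 1

/-- The value `w(γ₁, …, γₜ) ∈ G` of a word with constants `w ∈ 𝔽ₜ ∗ G`: each variable `yᵢ` is
replaced by `γᵢ` and each constant from `G` is kept. -/
def eval (γ : Fin t → G) : FreeGroup (Fin t) ∗ G →* G :=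
  Monoid.Coprod.lift (FreeGroup.lift γ) (MonoidHom.id G)

end Words

section UniqueForm

universe u

/-- The two factors of `𝔽ₜ ∗ G` as a family indexed by `Bool`. -/
abbrev Factor (G : Type u) (t : ℕ) : Bool → Type u
  | true => ULift.{u} (FreeGroup (Fin t))
  | false => G

instance factorGroup (G : Type u) [Group G] (t : ℕ) : ∀ b, Group (Factor G t b)
  | true => inferInstanceAs (Group (ULift.{u} (FreeGroup (Fin t))))
  | false => inferInstanceAs (Group G)

open Classical in
/-- The letters, from left to right, of the word given by a list. -/
noncomputable def letters {G : Type u} [Group G] {t : ℕ} :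
    List (FreeGroup (Fin t) × G) → List (Σ b, Factor G t b)
  | [] => []
  | (u, v) :: L => letters L ++
      ((if u = 1 then [] else [⟨true, ULift.up u⟩]) ++ [⟨false, v⟩])

/-- `𝔽ₜ ∗ G` mapped to the indexed free product of the two factors. -/
noncomputable def toCoprodI (G : Type u) [Group G] (t : ℕ) :
    FreeGroup (Fin t) ∗ G →* Monoid.CoprodI (Factor G t) :=
  Monoid.Coprod.lift
    ((Monoid.CoprodI.of (M := Factor G t) (i := true)).comp
      (MulEquiv.ulift : ULift.{u} (FreeGroup (Fin t)) ≃* FreeGroup (Fin t)).symm.toMonoidHom)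
    (Monoid.CoprodI.of (M := Factor G t) (i := false))

theorem letters_prod {G : Type u} [Group G] {t : ℕ} (L : List (FreeGroup (Fin t) × G)) :
    ((letters L).map fun l => Monoid.CoprodI.of l.2).prod = toCoprodI G t (ofForm L) := by
  induction L with
  | nil => simp [letters, ofForm]
  | cons a L ih =>
    obtain ⟨u, v⟩ := a
    have hu : toCoprodI G t (Monoid.Coprod.inl u) =
        Monoid.CoprodI.of (M := Factor G t) (i := true) (ULift.up u) := by
      simp only [toCoprodI, Monoid.Coprod.lift_apply_inl]; rfl
    have hv : toCoprodI G t (Monoid.Coprod.inr v) =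
        Monoid.CoprodI.of (M := Factor G t) (i := false) v := by
      simp only [toCoprodI, Monoid.Coprod.lift_apply_inr]
    simp only [letters, ofForm, List.map_append, List.prod_append, ih, map_mul, hv]
    split_ifs with h
    · subst h; simp
    · simp [hu]

theorem letters_getLast {G : Type u} [Group G] {t : ℕ}
    (L : List (FreeGroup (Fin t) × G)) : ∀ l ∈ (letters L).getLast?, l.1 = false := by
  cases L with
  | nil => simp [letters]
  | cons a L => simp [letters]

theorem dropLast_cons_mem {α : Type*} {a : α} {L : List α} (hL : L ≠ []) :
    (a :: L).dropLast = a :: L.dropLast := by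
  cases L with
  | nil => exact absurd rfl hL
  | cons b L => rfl

theorem letters_ne_one {G : Type u} [Group G] {t : ℕ} (L : List (FreeGroup (Fin t) × G))
    (h : ∀ a ∈ L, a.2 ≠ 1) : ∀ l ∈ letters L, l.2 ≠ 1 := by
  induction L with
  | nil => simp [letters]
  | cons a L ih =>
    obtain ⟨u, v⟩ := a
    intro l hl
    simp only [letters, List.mem_append] at hl
    rcases hl with hl | hl | hl
    · exact ih (fun a ha => h a (List.mem_cons_of_mem _ ha)) l hl
    · split_ifs at hl with h1
      · simp at hl
      · obtain rfl := List.mem_singleton.1 hl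
        intro h2
        exact h1 (congrArg ULift.down h2)
    · obtain rfl := List.mem_singleton.1 hl
      exact h (u, v) (by simp)

theorem letters_chain {G : Type u} [Group G] {t : ℕ} (L : List (FreeGroup (Fin t) × G))
    (h : ∀ a ∈ L.dropLast, a.1 ≠ 1) :
    (letters L).IsChain fun l l' => l.1 ≠ l'.1 := by
  induction L with
  | nil => simp [letters]
  | cons a L ih =>
    obtain ⟨u, v⟩ := a
    by_cases hL : L = []
    · subst hL
      by_cases h1 : u = 1 <;> simp [letters, h1]
    · rw [dropLast_cons_mem hL] at h
      have hu : u ≠ 1 := h (u, v) (by simp)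
      have ih' := ih fun a ha => h a (List.mem_cons_of_mem _ ha)
      simp only [letters, if_neg hu, List.singleton_append]
      rw [List.isChain_append]
      refine ⟨ih', by simp, ?_⟩
      intro x hx y hy
      have := letters_getLast L x hx
      simp at hy
      subst hy
      simp [this]

theorem letters_inj {G : Type u} [Group G] {t : ℕ} :
    ∀ L L' : List (FreeGroup (Fin t) × G), (∀ a ∈ L.dropLast, a.1 ≠ 1) →
      (∀ a ∈ L'.dropLast, a.1 ≠ 1) → letters L = letters L' → L = L' := by
  intro L
  induction L with
  | nil =>
    intro L' _ _ h
    cases L' with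
    | nil => rfl
    | cons b L' => simp [letters] at h
  | cons a L ih =>
    intro L' hL hL' h
    obtain ⟨u, v⟩ := a
    cases L' with
    | nil => simp [letters] at h
    | cons b L' =>
      obtain ⟨u', v'⟩ := b
      simp only [letters, ← List.append_assoc] at h
      obtain ⟨h1, h2⟩ := List.append_inj' h rfl
      have hv : v = v' := by simpa using h2
      subst hv
      have key : ∀ {u : FreeGroup (Fin t)} {M : List (FreeGroup (Fin t) × G)},
          (∀ a ∈ ((u, v) :: M).dropLast, a.1 ≠ 1) → u = 1 → M = [] := by
        intro u M hM hu
        by_contra hne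
        rw [dropLast_cons_mem hne] at hM
        exact hM (u, v) (by simp) hu
      have tl : ∀ {u : FreeGroup (Fin t)} {M : List (FreeGroup (Fin t) × G)},
          (∀ a ∈ ((u, v) :: M).dropLast, a.1 ≠ 1) → ∀ a ∈ M.dropLast, a.1 ≠ 1 := by
        intro u M hM a ha
        by_cases hne : M = []
        · subst hne; simp at ha
        · rw [dropLast_cons_mem hne] at hM
          exact hM a (List.mem_cons_of_mem _ ha)
      by_cases hu : u = 1 <;> by_cases hu' : u' = 1
      · rw [key hL hu, key hL' hu', hu, hu']
      · have := key hL hu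
        subst this
        simp [letters, hu, hu'] at h1
      · have := key hL' hu'
        subst this
        simp [letters, hu, hu'] at h1
      · simp only [if_neg hu, if_neg hu'] at h1
        obtain ⟨h3, h4⟩ := List.append_inj' h1 rfl
        have huu : u = u' := by simpa using h4
        rw [huu, ih L' (tl hL) (tl hL') h3]

/-- The reduced form `𝗎ₙ vₙ ⋯ 𝗎₁ v₁` of an element of `𝔽ₜ ∗ G` is unique. -/
theorem ofForm_injOn {G : Type u} [Group G] {t : ℕ} :
    Set.InjOn (ofForm (G := G) (t := t)) {L | IsReducedForm L} := by
  classical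
  intro L hL L' hL' h
  let w : Monoid.CoprodI.Word (Factor G t) :=
    ⟨letters L, letters_ne_one L hL.2.1, letters_chain L hL.2.2⟩
  let w' : Monoid.CoprodI.Word (Factor G t) :=
    ⟨letters L', letters_ne_one L' hL'.2.1, letters_chain L' hL'.2.2⟩
  have hw : w.prod = w'.prod := by
    change ((letters L).map _).prod = ((letters L').map _).prod
    exact (letters_prod L).trans ((congrArg _ h).trans (letters_prod L').symm)
  have hww : w = w' := Monoid.CoprodI.Word.equiv.symm.injective hw
  exact letters_inj L L' hL.2.2 hL'.2.2 (congrArg Monoid.CoprodI.Word.toList hww)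

end UniqueForm

section Oscillation

variable {G : Type*} [Group G] {t : ℕ} (X : Type*) [MulAction G X]

/-- The support of `g`: the set of points moved by `g`. -/
def supp (g : G) : Set X := {x | g • x ≠ x}

/-- `⋂_{i = 0}^{n - 1} v₁⁻¹ ⋯ vᵢ⁻¹ (supp vᵢ₊₁)` for the list `[v₁, …, vₙ]`. -/
def constantsOscillation (v : List G) : Set X :=
  ⋂ i : Fin v.length, ((v.take i).map (·⁻¹)).prod • supp X v[i]

open Classical in
/-- The set `O_w`. For `w ∈ 𝔽ₜ` it is the complement of the set of points fixed by `G`; for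
`w ∉ 𝔽ₜ` of the reduced form `𝗎ₙ vₙ ⋯ 𝗎₁ v₁` it is `⋂_{i = 0}^{n - 1} v₁⁻¹ ⋯ vᵢ⁻¹ (supp vᵢ₊₁)`.
The form is unique when it exists (`ofForm_injOn`), so the choice made here is immaterial. Words
of neither kind (those ending on the right with a variable, but not in `𝔽ₜ`) have no `O_w`;
they get the empty set and so are never explicitly oscillating. -/
noncomputable def oscillationSet (w : FreeGroup (Fin t) ∗ G) : Set X :=
  if w ∈ (Monoid.Coprod.inl : FreeGroup (Fin t) →* FreeGroup (Fin t) ∗ G).range then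
    (MulAction.fixedPoints G X)ᶜ
  else if h : ∃ L, IsReducedForm L ∧ ofForm L = w then
    constantsOscillation X (h.choose.map Prod.snd)
  else ∅

variable {X} in
/-- `w` is explicitly oscillating in `V`: it is non-trivial and `V ∩ O_w ≠ ∅`. -/
def ExplicitlyOscillatingIn (V : Set X) (w : FreeGroup (Fin t) ∗ G) : Prop :=
  w ≠ 1 ∧ (V ∩ oscillationSet X w).Nonempty

/-- `w` is explicitly oscillating: explicitly oscillating in the whole space. -/
def ExplicitlyOscillating (w : FreeGroup (Fin t) ∗ G) : Prop :=
  ExplicitlyOscillatingIn (univ : Set X) w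

end Oscillation

/-- The action of `G` on `X` is strongly topological: for every finite `Y ⊆ X` and `x ∈ X \ Y` the
pointwise stabilizer of `Y ∪ {x}` is closed in the pointwise stabilizer of `Y` and null for the
(left) Haar measure of the latter. -/
def StronglyTopological (G X : Type*) [Group G] [TopologicalSpace G] [MeasurableSpace G]
    [MulAction G X] : Prop :=
  ∀ Y : Set X, Y.Finite → ∀ x ∉ Y,
    IsClosed (((fixingSubgroup G (insert x Y)).subgroupOf (fixingSubgroup G Y) :
      Subgroup (fixingSubgroup G Y)) : Set (fixingSubgroup G Y)) ∧
    ∀ ν : Measure (fixingSubgroup G Y), ν.IsHaarMeasure →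
      ν ((fixingSubgroup G (insert x Y)).subgroupOf (fixingSubgroup G Y)) = 0

end MixedInequality

namespace MixedInequality

/-! ### Null sets of Haar measures on closed subgroups -/

section Haar

variable {K : Type*} [Group K] [TopologicalSpace K]

/-! `O_w = X` forces every constant of `w` to act without fixed points, since `O_w` is an
intersection of translates of their supports. So fix `x` and follow it through `w(γ)` letter by
letter, from the right, revealing `γ` only as far as needed; the end of the trajectory almost surely
differs from `x`.

The revealed state is `γ = A(false)⁻¹ h A(true)` with `h` random in a closed group `fixTuples G Y`,
where `Y i` is the finite set of points already used by the `i`-th entry. If the next letter applies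
`h i` or its inverse to `p ∉ Y i`, write `h` as `k⁻¹ l` or `l k`, with `l` fixing `p` too: the image
is `k_i⁻¹ p`, `k` is absorbed into `A`, and `l` stays random. This is Fubini
(`HaarAE.of_translate`). As point stabilizers are null, `k_i⁻¹ p` almost surely avoids any finite
set (`haarAE_smul_notMem`), so the next point is fresh again. Only a letter followed by its inverse
could return to `p`, and then the constant between them would have a fixed point. The induction is
`NonBacktracking.haarAE_smul_ne`. -/

instance secondCountableTopology_subgroup [SecondCountableTopology K] (S : Subgroup K) :
    SecondCountableTopology S :=
  inferInstanceAs (SecondCountableTopology (S : Set K))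

theorem locallyCompactSpace_subgroup [LocallyCompactSpace K] {S : Subgroup K}
    (hS : IsClosed (S : Set K)) : LocallyCompactSpace S :=
  hS.isClosedEmbedding_subtypeVal.locallyCompactSpace

variable [MeasurableSpace K]

/-- `P` holds almost everywhere on the subgroup `S` for every Haar measure of `S`. -/
def HaarAE (S : Subgroup K) (P : S → Prop) : Prop :=
  ∀ ν : Measure S, ν.IsHaarMeasure → ∀ᵐ h ∂ν, P h

theorem HaarAE.mono {S : Subgroup K} {P Q : S → Prop} (h : HaarAE S P) (hPQ : ∀ k, P k → Q k) :
    HaarAE S Q :=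
  fun ν hν => (h ν hν).mono hPQ

/-- By Fubini, some single `l` satisfies `P (m k l)` for almost all `k`; `hnull` then removes the
translation by this `l`. -/
theorem ae_of_ae_ae_translate {K L : Type*} [MeasurableSpace K] [MeasurableSpace L] {μ : Measure K} [SFinite μ]
    {ν : Measure L} [SFinite ν] [NeZero ν] {P : K → Prop} (m : K → L → K)
    (hm : MeasurableSet {q : K × L | P (m q.1 q.2)})
    (hnull : ∀ l, (∀ᵐ k ∂μ, P (m k l)) → ∀ᵐ k ∂μ, P k)
    (h : ∀ᵐ k ∂μ, ∀ᵐ l ∂ν, P (m k l)) : ∀ᵐ k ∂μ, P k := by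
  rw [Measure.ae_ae_comm (p := fun k l => P (m k l)) hm] at h
  obtain ⟨l, hl⟩ := h.exists
  exact hnull l hl

variable [IsTopologicalGroup K] [SecondCountableTopology K] [BorelSpace K]

theorem ae_of_ae_ae_inv_mul {L : Type*} [MeasurableSpace L] {μ : Measure K} [SFinite μ]
    [μ.IsMulLeftInvariant] {ν : Measure L} [SFinite ν] [NeZero ν] {P : K → Prop} {j : L → K}
    (hj : Measurable j) (hP : MeasurableSet {k | P k})
    (h : ∀ᵐ k ∂μ, ∀ᵐ l ∂ν, P (k⁻¹ * j l)) : ∀ᵐ k ∂μ, P k := by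
  refine ae_of_ae_ae_translate (fun k l => k⁻¹ * j l) ?_ ?_ h
  · exact hP.preimage (f := fun q : K × L => q.1⁻¹ * j q.2) (by fun_prop)
  · intro l hl
    rw [ae_iff] at hl ⊢
    -- Inversion and right translation preserve null sets of a left invariant measure, even without
    -- unimodularity.
    have h1 : μ ((fun k => k * j l) ⁻¹' {k | ¬ P k}) = 0 := by
      rw [← measure_inv_null]
      exact hl
    rwa [measure_mul_right_null] at h1

theorem ae_of_ae_ae_mul {L : Type*} [MeasurableSpace L] {μ : Measure K} [SFinite μ]
    [μ.IsMulLeftInvariant] {ν : Measure L} [SFinite ν] [NeZero ν] {P : K → Prop} {j : L → K}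
    (hj : Measurable j) (hP : MeasurableSet {k | P k})
    (h : ∀ᵐ k ∂μ, ∀ᵐ l ∂ν, P (j l * k)) : ∀ᵐ k ∂μ, P k := by
  refine ae_of_ae_ae_translate (fun k l => j l * k) ?_ ?_ h
  · exact hP.preimage (f := fun q : K × L => j q.2 * q.1) (by fun_prop)
  · intro l hl
    rw [ae_iff] at hl ⊢
    have h1 : μ ((fun k => j l * k) ⁻¹' {k | ¬ P k}) = 0 := hl
    rwa [measure_preimage_mul] at h1

variable [LocallyCompactSpace K]

theorem exists_haar_subgroup {S : Subgroup K} (hS : IsClosed (S : Set K)) :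
    ∃ ν : Measure S, ν.IsHaarMeasure ∧ SigmaFinite ν := by
  have := locallyCompactSpace_subgroup hS
  exact ⟨Measure.haar, inferInstance, inferInstance⟩

/-- Disintegration of null sets along a closed subgroup `S' ≤ S`. The sign `b` says on which side
the translation is made. -/
theorem HaarAE.of_translate {S S' : Subgroup K} (hS : IsClosed (S : Set K))
    (hS' : IsClosed (S' : Set K)) (hle : S' ≤ S) (b : Bool) {P : S → Prop}
    (hP : MeasurableSet {k | P k})
    (h : HaarAE S fun k => HaarAE S' fun l =>
      P (cond b (k⁻¹ * Subgroup.inclusion hle l) (Subgroup.inclusion hle l * k))) :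
    HaarAE S P := by
  intro μ hμ
  have := locallyCompactSpace_subgroup hS
  obtain ⟨ν, hν, _⟩ := exists_haar_subgroup hS'
  have hj : Measurable (Subgroup.inclusion hle) :=
    (continuous_inclusion (show (S' : Set K) ⊆ S from hle)).measurable
  have h' := (h μ hμ).mono fun k hk => hk ν hν
  cases b
  · exact ae_of_ae_ae_mul hj hP h'
  · exact ae_of_ae_ae_inv_mul hj hP h'

theorem ae_of_haarAE_translate {S : Subgroup K} (hS : IsClosed (S : Set K)) {μ : Measure K}
    [μ.IsHaarMeasure] {P : K → Prop} (hP : MeasurableSet {k | P k})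
    (h : ∀ k : K, HaarAE S fun l => P (k⁻¹ * l)) : ∀ᵐ k ∂μ, P k := by
  obtain ⟨ν, hν, _⟩ := exists_haar_subgroup hS
  exact ae_of_ae_ae_inv_mul (j := fun l : S => (l : K)) measurable_subtype_coe hP
    (.of_forall fun k => h k ν hν)

/-- Steinhaus: if `H` had positive measure, `H / H = H` would be a neighbourhood of `1`. -/
theorem haar_eq_zero_of_not_isOpen [T2Space K] {μ : Measure K} [μ.IsHaarMeasure] {H : Subgroup K}
    (hH : IsClosed (H : Set K)) (hop : ¬ IsOpen (H : Set K)) : μ H = 0 := by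
  by_contra hne
  let _ := TopologicalSpace.metrizableSpaceMetric K
  have := Measure.div_mem_nhds_one_of_haar_pos μ (H : Set K) hH.measurableSet
    (pos_iff_ne_zero.2 hne)
  rw [coe_div_coe] at this
  exact hop (H.isOpen_of_mem_nhds this)

end Haar

/-! ### Pointwise stabilizers of tuples and random orbits -/

section Stabilizers

variable {G : Type*} [Group G] {X : Type*} [MulAction G X] {ι : Type*}

/-- The tuples whose `i`-th entry fixes `Y i` pointwise. -/
def fixTuples (G : Type*) [Group G] {X : Type*} [MulAction G X] {ι : Type*} (Y : ι → Set X) :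
    Subgroup (ι → G) :=
  Subgroup.pi univ fun i => fixingSubgroup G (Y i)

theorem mem_fixTuples {Y : ι → Set X} {h : ι → G} :
    h ∈ fixTuples G Y ↔ ∀ i, ∀ y ∈ Y i, h i • y = y := by
  simp [fixTuples, Subgroup.mem_pi, mem_fixingSubgroup_iff]

theorem fixTuples_anti {Y Y' : ι → Set X} (h : ∀ i, Y i ⊆ Y' i) :
    fixTuples G Y' ≤ fixTuples G Y :=
  fun _ hk => mem_fixTuples.2 fun i y hy => mem_fixTuples.1 hk i y (h i hy)

variable [TopologicalSpace G]

theorem isClosed_smul_eq [IsTopologicalGroup G]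
    (hst : ∀ x : X, IsClosed (MulAction.stabilizer G x : Set G)) (x y : X) :
    IsClosed {g : G | g • x = y} := by
  by_cases hne : ∃ g : G, g • x = y
  · obtain ⟨g, rfl⟩ := hne
    have : {k : G | k • x = g • x} = (fun k => g⁻¹ * k) ⁻¹' MulAction.stabilizer G x := by
      ext k
      simp [mul_smul, inv_smul_eq_iff]
    rw [this]
    exact (hst x).preimage (by fun_prop)
  · convert isClosed_empty
    exact eq_empty_of_forall_notMem fun g hg => hne ⟨g, hg⟩

theorem isClosed_fixTuples [IsTopologicalGroup G]
    (hst : ∀ x : X, IsClosed (MulAction.stabilizer G x : Set G)) (Y : ι → Set X) :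
    IsClosed (fixTuples G Y : Set (ι → G)) := by
  have : (fixTuples G Y : Set (ι → G)) = ⋂ i, ⋂ y ∈ Y i, {h | h i • y = y} := by
    ext h
    simp [mem_fixTuples]
  rw [this]
  exact isClosed_iInter fun i => isClosed_biInter fun y _ =>
    (isClosed_smul_eq hst y y).preimage (f := fun h : ι → G => h i) (continuous_apply i)

variable [MeasurableSpace G]

theorem StronglyTopological.isClosed_stabilizer (hG : StronglyTopological G X) (x : X) :
    IsClosed (MulAction.stabilizer G x : Set G) := by
  have h := (hG ∅ finite_empty x (notMem_empty x)).1
  have hmem : ∀ g : G, g ∈ fixingSubgroup G (∅ : Set X) := by simp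
  have := h.preimage (f := fun g : G => (⟨g, hmem g⟩ : fixingSubgroup G (∅ : Set X)))
    (by fun_prop)
  convert this
  ext g
  simp only [SetLike.mem_coe, MulAction.mem_stabilizer_iff, mem_preimage, Subgroup.mem_subgroupOf,
    mem_fixingSubgroup_iff, insert_empty_eq, mem_singleton_iff, forall_eq]

variable [IsTopologicalGroup G] [LocallyCompactSpace G] [SecondCountableTopology G] [BorelSpace G]

/-- Nonempty open sets have positive Haar measure. Unlike nullity, non-openness passes easily to
products of stabilizers. -/
theorem StronglyTopological.not_isOpen (hG : StronglyTopological G X) {Y : Set X}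
    (hY : Y.Finite) {x : X} (hx : x ∉ Y) :
    ¬ IsOpen (((fixingSubgroup G (insert x Y)).subgroupOf (fixingSubgroup G Y) :
      Subgroup (fixingSubgroup G Y)) : Set (fixingSubgroup G Y)) := by
  intro ho
  have hcl : IsClosed (fixingSubgroup G Y : Set G) := by
    have : (fixingSubgroup G Y : Set G) = ⋂ y ∈ Y, {h : G | h • y = y} := by
      ext h
      simp [mem_fixingSubgroup_iff]
    rw [this]
    exact isClosed_biInter fun y _ => isClosed_smul_eq hG.isClosed_stabilizer y y
  obtain ⟨ν, hν, _⟩ := exists_haar_subgroup hcl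
  exact ho.measure_ne_zero ν ⟨1, one_mem _⟩ ((hG Y hY x hx).2 ν hν)

/-- The orbit of a point outside `Y i` under a random tuple fixing all `Y i` avoids any given
point almost surely. -/
theorem StronglyTopological.haarAE_smul_ne [T2Space G] [Fintype ι] (hG : StronglyTopological G X)
    {Y : ι → Set X} {i : ι} (hY : (Y i).Finite) {p : X} (hp : p ∉ Y i) (f : X) :
    HaarAE (fixTuples G Y) fun k => (k.1 i)⁻¹ • p ≠ f := by
  classical
  intro ν hν
  have hst := hG.isClosed_stabilizer
  have := locallyCompactSpace_subgroup (isClosed_fixTuples (G := G) hst Y)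
  let H : Subgroup (fixTuples G Y) := (MulAction.stabilizer G p).comap
    ((Pi.evalMonoidHom (fun _ => G) i).comp (fixTuples G Y).subtype)
  have hH : IsClosed (H : Set (fixTuples G Y)) :=
    (hst p).preimage (f := fun k : fixTuples G Y => k.1 i)
      ((continuous_apply i).comp continuous_subtype_val)
  have hop : ¬ IsOpen (H : Set (fixTuples G Y)) := by
    intro ho
    -- Insertion into the `i`-th coordinate pulls `H` back to the stabilizer of `Y i ∪ {p}` inside
    -- that of `Y i`.
    have hmem : ∀ g : fixingSubgroup G (Y i), Pi.mulSingle i g.1 ∈ fixTuples G Y := by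
      intro g
      rw [mem_fixTuples]
      intro j y hy
      by_cases hj : j = i
      · subst hj
        rw [Pi.mulSingle_eq_same]
        exact (mem_fixingSubgroup_iff G).1 g.2 y hy
      · rw [Pi.mulSingle_eq_of_ne hj, one_smul]
    refine hG.not_isOpen hY hp ?_
    have := ho.preimage (f := fun g : fixingSubgroup G (Y i) =>
      (⟨Pi.mulSingle i g.1, hmem g⟩ : fixTuples G Y))
      (Continuous.subtype_mk ((continuous_mulSingle (A := fun _ => G) i).comp
        continuous_subtype_val) _)
    convert this
    ext g
    have hg := (mem_fixingSubgroup_iff G).1 g.2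
    simpa [Subgroup.mem_subgroupOf, mem_fixingSubgroup_iff, H] using fun _ => hg
  have h0 := haar_eq_zero_of_not_isOpen (μ := ν) hH hop
  rw [ae_iff]
  simp only [ne_eq, not_not]
  by_cases hne : ∃ k : fixTuples G Y, (k.1 i)⁻¹ • p = f
  · obtain ⟨k₀, rfl⟩ := hne
    -- The exceptional set is the coset `H k₀`.
    rw [← measure_mul_right_null ν k₀⁻¹] at h0
    convert h0 using 2
    ext k
    change (k.1 i)⁻¹ • p = (k₀.1 i)⁻¹ • p ↔ (k.1 i * (k₀.1 i)⁻¹) • p = p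
    rw [mul_smul, inv_smul_eq_iff, eq_comm]
  · convert measure_empty (μ := ν)
    exact eq_empty_of_forall_notMem fun g hg => hne ⟨g, hg⟩

theorem StronglyTopological.haarAE_smul_notMem [T2Space G] [Fintype ι] (hG : StronglyTopological G X)
    {Y : ι → Set X} {i : ι} (hY : (Y i).Finite) {p : X} (hp : p ∉ Y i) {F : Set X}
    (hF : F.Finite) : HaarAE (fixTuples G Y) fun k => (k.1 i)⁻¹ • p ∉ F := by
  intro ν hν
  have := (ae_ball_iff hF.countable).2 fun f (_ : f ∈ F) => hG.haarAE_smul_ne hY hp f ν hν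
  filter_upwards [this] with k hk hkF
  exact hk _ hkF rfl

end Stabilizers

/-! ### Word maps in order of application -/

section WordMaps

variable {G : Type*} [Group G] {ι : Type*}

/-- The value of the letter `yᵢ` (for `b = true`) or `yᵢ⁻¹` (for `b = false`). -/
def letterVal (γ : ι → G) (a : ι × Bool) : G :=
  cond a.2 (γ a.1) (γ a.1)⁻¹

/-- The word maps `γ ↦ e γ_{i_k}^{±1} c_k ⋯ γ_{i_1}^{±1} c_1`, to be applied after the letter
`prev` (if any), such that every constant standing between a letter and its inverse acts on `X`
without fixed points. If the word is a constant and there is no previous letter, then this constant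
is also required to act without fixed points. -/
inductive NonBacktracking (X : Type*) [MulAction G X] :
    Option (ι × Bool) → ((ι → G) → G) → Prop
  | const (prev : Option (ι × Bool)) (e : G) (he : prev = none → ∀ x : X, e • x ≠ x) :
      NonBacktracking X prev fun _ => e
  | step (prev : Option (ι × Bool)) (c : G) (i : ι) (b : Bool) (f : (ι → G) → G)
      (hc : prev = some (i, !b) → ∀ x : X, c • x ≠ x) (hf : NonBacktracking X (some (i, b)) f) :
      NonBacktracking X prev fun γ => f γ * (letterVal γ (i, b) * c)

theorem NonBacktracking.continuous [TopologicalSpace G] [IsTopologicalGroup G] {X : Type*}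
    [MulAction G X] {prev : Option (ι × Bool)} {f : (ι → G) → G}
    (hf : NonBacktracking X prev f) : Continuous f := by
  induction hf with
  | const => exact continuous_const
  | step prev c i b f hc hf ih =>
    refine ih.mul (.mul ?_ continuous_const)
    cases b
    · exact (continuous_apply i).inv
    · exact continuous_apply i

end WordMaps

/-! ### Following a point through the word -/

section Trajectory

variable {G : Type*} [Group G] {X : Type*} [MulAction G X] {ι : Type*}

/-- The tuple `h` translated by the tuples `A false` and `A true`. -/
def twist (A : Bool → ι → G) (h : ι → G) : ι → G :=
  (A false)⁻¹ * h * A true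

/-- Conditioning on `k` only changes `A` on one side: the left one for a letter `yᵢ`, the right one
for `yᵢ⁻¹`. -/
theorem twist_update (A : Bool → ι → G) (b : Bool) (k h : ι → G) :
    twist (Function.update A (!b) (k * A (!b))) h = twist A (cond b (k⁻¹ * h) (h * k)) := by
  cases b <;> simp [twist, mul_assoc]

theorem letterVal_twist (A : Bool → ι → G) (h : ι → G) (i : ι) (b : Bool) :
    letterVal (twist A h) (i, b) = (A (!b) i)⁻¹ * (cond b (h i) (h i)⁻¹ * A b i) := by
  cases b <;> simp [letterVal, twist, mul_assoc]

theorem letterVal_twist_smul [DecidableEq ι] (A : Bool → ι → G) {Y : ι → Set X} {i : ι} {p : X}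
    {h : ι → G} (hh : h ∈ fixTuples G (Function.update Y i (insert p (Y i)))) (b : Bool)
    (k : ι → G) :
    letterVal (twist (Function.update A (!b) (k * A (!b))) h) (i, b) • (A b i)⁻¹ • p =
      (A (!b) i)⁻¹ • (k i)⁻¹ • p := by
  have hp : h i • p = p := mem_fixTuples.1 hh i p (by simp)
  have hp' : (h i)⁻¹ • p = p := inv_smul_eq_iff.2 hp.symm
  rw [letterVal_twist]
  cases b <;> simp [mul_smul, hp, hp']

variable [TopologicalSpace G] [MeasurableSpace G]
variable [IsTopologicalGroup G]

theorem measurableSet_smul_ne (hG : StronglyTopological G X) {α : Type*} [TopologicalSpace α]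
    [MeasurableSpace α] [OpensMeasurableSpace α] {φ : α → G} (hφ : Continuous φ) (x y : X) :
    MeasurableSet {a | φ a • x ≠ y} :=
  ((isClosed_smul_eq hG.isClosed_stabilizer x y).preimage hφ).measurableSet.compl

variable [LocallyCompactSpace G] [SecondCountableTopology G] [BorelSpace G] [Fintype ι]

/-- One step of a trajectory: the tuples in `fixTuples G Y` are disintegrated along the image of
the point `p` under their `i`-th entry. -/
theorem StronglyTopological.haarAE_step [DecidableEq ι] (hG : StronglyTopological G X)
    {f : (ι → G) → G} (hf : Continuous f) (A : Bool → ι → G) (Y : ι → Set X) {i : ι} {b : Bool}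
    {c : G} {x p x₀ : X} (hp : A b i • c • x = p)
    (h : HaarAE (fixTuples G Y) fun k =>
      HaarAE (fixTuples G (Function.update Y i (insert p (Y i)))) fun h =>
        f (twist (Function.update A (!b) (k.1 * A (!b))) h.1) •
          (A (!b) i)⁻¹ • (k.1 i)⁻¹ • p ≠ x₀) :
    HaarAE (fixTuples G Y) fun h =>
      (f (twist A h.1) * (letterVal (twist A h.1) (i, b) * c)) • x ≠ x₀ := by
  have hst := hG.isClosed_stabilizer
  have hle : fixTuples G (Function.update Y i (insert p (Y i))) ≤ fixTuples G Y := by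
    refine fixTuples_anti fun j => ?_
    by_cases hj : j = i
    · subst hj
      simp
    · simp [hj]
  refine HaarAE.of_translate (isClosed_fixTuples hst Y) (isClosed_fixTuples hst _) hle b ?_ ?_
  · refine measurableSet_smul_ne hG ?_ x x₀
    have ht : Continuous fun h : fixTuples G Y => twist A h.1 := by
      unfold twist
      fun_prop
    refine (hf.comp ht).mul (.mul ?_ continuous_const)
    cases b
    · exact ((continuous_apply i).comp ht).inv
    · exact (continuous_apply i).comp ht
  · refine h.mono fun k hk => hk.mono fun l hl => ?_
    have hx : c • x = (A b i)⁻¹ • p := by rw [← hp, inv_smul_smul]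
    have htw : twist A (cond b (k⁻¹ * Subgroup.inclusion hle l)
        (Subgroup.inclusion hle l * k) : fixTuples G Y).1 =
        twist (Function.update A (!b) (k.1 * A (!b))) l.1 := by
      rw [twist_update]
      cases b <;> rfl
    rw [htw, mul_smul, mul_smul, hx, letterVal_twist_smul A l.2]
    exact hl

/-- Induction along the word: the letter `prev` has just been applied at the fresh point `p`, its
outcome is governed by `k`, and `f` is still to come. -/
theorem NonBacktracking.haarAE_smul_ne [T2Space G] [DecidableEq ι] (hG : StronglyTopological G X)
    {prev : Option (ι × Bool)} {f : (ι → G) → G} (hf : NonBacktracking X prev f) :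
    ∀ {i : ι} {b : Bool}, prev = some (i, b) → ∀ (A : Bool → ι → G) (Y : ι → Set X),
      (∀ j, (Y j).Finite) → ∀ p ∉ Y i, ∀ x₀ : X, HaarAE (fixTuples G Y) fun k =>
        HaarAE (fixTuples G (Function.update Y i (insert p (Y i)))) fun h =>
          f (twist (Function.update A (!b) (k.1 * A (!b))) h.1) •
            (A (!b) i)⁻¹ • (k.1 i)⁻¹ • p ≠ x₀ := by
  induction hf with
  | const prev e he =>
    rintro i b - A Y hY p hp x₀
    refine (hG.haarAE_smul_notMem (hY i) hp
      (finite_singleton (A (!b) i • e⁻¹ • x₀))).mono fun k hk ν _ => .of_forall fun h heq => ?_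
    rw [← heq] at hk
    simp at hk
  | step prev c j d f hc hf ih =>
    rintro i b rfl A Y hY p hp x₀
    -- The finite set `F` consists of the values of `k_i⁻¹ p` that the next letter, read with the
    -- old `A`, would send into `Y j ∪ {p}`.
    refine (hG.haarAE_smul_notMem (hY i) hp (F := (A (!b) i * c⁻¹ * (A d j)⁻¹) • insert p (Y j))
      (((hY j).insert p).smul_set)).mono fun k hk => ?_
    set Y' := Function.update Y i (insert p (Y i)) with hY'
    set A' := Function.update A (!b) (k.1 * A (!b)) with hA'
    have hY'fin : ∀ l, (Y' l).Finite := by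
      intro l
      by_cases hl : l = i
      · subst hl
        simpa [hY'] using (hY l).insert p
      · simpa [hY', hl] using hY l
    have hY'sub : Y' j ⊆ insert p (Y j) := by
      by_cases hl : j = i
      · subst hl
        simp [hY']
      · simp [hY', hl]
    have hk' : A d j • c • (A (!b) i)⁻¹ • (k.1 i)⁻¹ • p ∉ insert p (Y j) := by
      intro hmem
      refine hk (mem_smul_set.2 ⟨_, hmem, ?_⟩)
      simp [mul_smul]
    refine hG.haarAE_step hf.continuous A' Y' rfl (ih rfl A' Y' hY'fin _ ?_ x₀)
    intro hmem
    -- For `d = !b` the next letter reads the side of `A` just multiplied by `k`. As `k j` fixes `Y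
    -- j` pointwise, it brings no outside point into `Y j`; a return to `p` needs `j = i` and a
    -- fixed point of `c`.
    by_cases hd : d = !b
    · subst hd
      simp only [hA', Function.update_self, Pi.mul_apply, mul_smul] at hmem
      have hkY : k.1 j • A (!b) j • c • (A (!b) i)⁻¹ • (k.1 i)⁻¹ • p ∉ Y j := by
        intro hkY
        have hfix := mem_fixTuples.1 k.2 j _ hkY
        rw [smul_left_cancel_iff] at hfix
        rw [hfix] at hkY
        exact hk' (mem_insert_of_mem _ hkY)
      by_cases hl : j = i
      · subst hl
        simp only [hY', Function.update_self] at hmem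
        have heq := hmem.resolve_right hkY
        rw [← eq_inv_smul_iff, ← eq_inv_smul_iff] at heq
        exact hc (by simp) _ heq
      · simp only [hY', Function.update_of_ne hl] at hmem
        exact hkY hmem
    · rw [hA', Function.update_of_ne hd] at hmem
      exact hk' (hY'sub hmem)

theorem NonBacktracking.ae_ne_one [T2Space G] (hG : StronglyTopological G X) [Nonempty X] {f : (ι → G) → G}
    (hf : NonBacktracking X none f) (μ : Measure G) [μ.IsHaarMeasure] :
    ∀ᵐ γ ∂(Measure.pi fun _ : ι => μ), f γ ≠ 1 := by
  classical
  obtain ⟨x⟩ := ‹Nonempty X›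
  have hcont := hf.continuous
  suffices ∀ᵐ γ ∂(Measure.pi fun _ : ι => μ), f γ • x ≠ x from
    this.mono fun γ hγ h1 => hγ (by rw [h1, one_smul])
  cases hf with
  | const _ e he => exact .of_forall fun _ => he rfl x
  | step _ c i b f hc hf =>
    refine ae_of_haarAE_translate
      (isClosed_fixTuples (G := G) hG.isClosed_stabilizer fun _ : ι => (∅ : Set X))
      (measurableSet_smul_ne hG hcont x x) fun k => ?_
    -- Initially nothing is fixed; `A false = k` and `A true = 1` encode the translate `k⁻¹ h`.
    have := hG.haarAE_step hf.continuous (fun d => cond d 1 k) (fun _ => ∅) (i := i) (b := b)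
      (c := c) (x := x) rfl (hf.haarAE_smul_ne hG rfl _ _ (fun _ => finite_empty) _
        (notMem_empty _) x)
    simpa [twist] using this

end Trajectory

/-! ### From reduced forms to non-backtracking word maps -/

section Words

variable {G : Type*} [Group G] {X : Type*} [MulAction G X] {t : ℕ}

/-- Inside a free group factor the constants are `1`, which may fix points; reducedness excludes
backtracking there. The list `l` is in order of application, hence the reversals. -/
theorem NonBacktracking.mul_letters {f : (Fin t → G) → G}
    (hf : ∀ a, NonBacktracking X (some a) f) :
    ∀ (l : List (Fin t × Bool)), l ≠ [] → FreeGroup.IsReduced l.reverse →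
      ∀ (c : G) (prev : Option (Fin t × Bool)),
        (∀ i b, l.head? = some (i, b) → prev = some (i, !b) → ∀ x : X, c • x ≠ x) →
        NonBacktracking X prev fun γ =>
          f γ * ((l.reverse.map (letterVal γ)).prod * c) := by
  intro l
  induction l with
  | nil => exact fun h => absurd rfl h
  | cons a l ih =>
    obtain ⟨i, b⟩ := a
    intro _ hred c prev hc
    rcases eq_or_ne l [] with rfl | hl
    · simpa using NonBacktracking.step prev c i b f (hc i b rfl) (hf (i, b))
    · have hred' : FreeGroup.IsReduced l.reverse :=
        hred.infix ⟨[], [(i, b)], by simp⟩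
      have := ih hl hred' 1 (some (i, b)) ?_
      · convert NonBacktracking.step prev c i b _ (hc i b rfl) this using 2 with γ
        simp [mul_assoc]
      · intro j d hj hprev
        exfalso
        cases l with
        | nil => exact hl rfl
        | cons a' l =>
          simp only [List.head?_cons, Option.some.injEq] at hj hprev
          subst hj
          have hchain : List.IsChain (fun a b : Fin t × Bool => a.1 = b.1 → a.2 = b.2)
              (l.reverse ++ [(j, d)]) ∧ (j = i → d = b) := by
            simpa [FreeGroup.IsReduced] using hred
          obtain ⟨rfl, hbd⟩ := Prod.mk.inj hprev
          rw [hchain.2 rfl] at hbd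
          simp at hbd

theorem NonBacktracking.mul_freeGroup {f : (Fin t → G) → G}
    (hf : ∀ a, NonBacktracking X (some a) f) {u : FreeGroup (Fin t)} (hu : u ≠ 1) {c : G}
    {prev : Option (Fin t × Bool)} (hc : prev = none ∨ ∀ x : X, c • x ≠ x) :
    NonBacktracking X prev fun γ => f γ * (FreeGroup.lift γ u * c) := by
  have := mul_letters hf u.toWord.reverse (by simpa using hu)
    (by simpa using FreeGroup.isReduced_toWord) c prev
    fun i b _ hprev => hc.resolve_left (by simp [hprev])
  convert this using 4 with γ
  conv_lhs => rw [← FreeGroup.mk_toWord (x := u)]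
  rw [FreeGroup.lift_mk, List.reverse_reverse]
  rfl

theorem NonBacktracking.of_isReducedForm (L : List (FreeGroup (Fin t) × G)) (hne : L ≠ [])
    (hL : ∀ a ∈ L.dropLast, a.1 ≠ 1) (hv : ∀ a ∈ L, ∀ x : X, a.2 • x ≠ x) :
    ∀ prev, NonBacktracking X prev fun γ => eval γ (ofForm L) := by
  induction L with
  | nil => exact absurd rfl hne
  | cons a L ih =>
    obtain ⟨u, v⟩ := a
    intro prev
    have hvx := hv (u, v) (by simp)
    have key : ∀ γ, eval γ (ofForm ((u, v) :: L)) =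
        eval γ (ofForm L) * (FreeGroup.lift γ u * v) := by
      intro γ
      simp [ofForm, eval]
    simp only [key]
    rcases eq_or_ne L [] with rfl | hL'
    -- The leftmost factor may be trivial; the word then ends with the constant `v`.
    · by_cases hu : u = 1
      · subst hu
        simpa [ofForm] using NonBacktracking.const prev v fun _ => hvx
      · refine mul_freeGroup (fun a => ?_) hu (.inr hvx)
        simpa [ofForm] using NonBacktracking.const (X := X) (some a) (1 : G) (by simp)
    · rw [dropLast_cons_mem hL'] at hL
      exact mul_freeGroup
        (fun a => ih hL' (fun a ha => hL a (List.mem_cons_of_mem _ ha))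
          (fun a ha => hv a (List.mem_cons_of_mem _ ha)) _) (hL (u, v) (by simp)) (.inr hvx)

theorem smul_ne_of_constantsOscillation_eq_univ {v : List G}
    (h : constantsOscillation X v = univ) : ∀ g ∈ v, ∀ x : X, g • x ≠ x := by
  intro g hg x
  obtain ⟨i, hi, rfl⟩ := List.mem_iff_getElem.1 hg
  -- Testing at the translate of `x` cancels the prefix `v₁⁻¹ ⋯ vᵢ⁻¹`.
  have := eq_univ_iff_forall.1 h (((v.take i).map (·⁻¹)).prod • x)
  have := mem_iInter.1 this ⟨i, hi⟩
  exact smul_mem_smul_set_iff.1 this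

theorem NonBacktracking.of_oscillationSet_eq_univ [Nonempty X] {w : FreeGroup (Fin t) ∗ G}
    (hw : w ≠ 1) (hosc : oscillationSet X w = univ) :
    NonBacktracking X none fun γ => eval γ w := by
  unfold oscillationSet at hosc
  split_ifs at hosc with h1 h2
  · obtain ⟨u, rfl⟩ := h1
    have hu : u ≠ 1 := by
      rintro rfl
      exact hw (map_one _)
    have := mul_freeGroup (X := X) (G := G) (f := fun _ => 1) (prev := none) (c := 1)
      (fun a => .const _ _ (by simp)) hu (.inl rfl)
    simpa [eval] using this
  · obtain ⟨hL, hw⟩ := h2.choose_spec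
    have := of_isReducedForm (X := X) _ hL.1 hL.2.2
      (fun a ha => smul_ne_of_constantsOscillation_eq_univ hosc _ (List.mem_map_of_mem ha)) none
    rwa [hw] at this
  · exact absurd hosc empty_ne_univ

end Words

end MixedInequality

/- The hypothesis `hstab` is not used: for nonempty `X` it follows from `hG`, since no `G`-stabilizer
of a finite set can then be discrete. -/
theorem corollary3p4
    {G : Type*} [Group G] [TopologicalSpace G] [IsTopologicalGroup G] [T2Space G]
    [LocallyCompactSpace G] [SecondCountableTopology G] [MeasurableSpace G] [BorelSpace G]
    {X : Type*} [MetricSpace X] [PolishSpace X] [MulAction G X] [IsIsometricSMul G X]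
    (hG : MixedInequality.StronglyTopological G X)
    (hstab : ∀ Y : Set X, Y.Finite → fixingSubgroup G Y ≠ ⊥)
    (μ : Measure G) [μ.IsHaarMeasure] (t : ℕ)
    (W : Set (FreeGroup (Fin t) ∗ G)) (hW : W.Countable)
    (hosc : ∀ w ∈ W, MixedInequality.ExplicitlyOscillating X w ∧
      MixedInequality.oscillationSet X w = univ) :
    ∀ᵐ γ ∂(Measure.pi fun _ : Fin t => μ), ∀ w ∈ W, MixedInequality.eval γ w ≠ 1 := by
  refine (ae_ball_iff hW).2 fun w hw => ?_
  obtain ⟨⟨hw1, x, -⟩, hu⟩ := hosc w hw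
  have : Nonempty X := ⟨x⟩
  exact (MixedInequality.NonBacktracking.of_oscillationSet_eq_univ hw1 hu).ae_ne_one hG μ
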